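/- Let $N\ge 1$ and let $\Omega\subset\mathbb R^N$ be a Lipschitz domain, i.e. a nonempty connected open (possibly unbounded) set which near each of its boundary points coincides, after a rotation of coordinates, with the strict epigraph of a Lipschitz function of $N-1$ variables. Let $\Gamma$ be a nonempty relatively open subset of $\partial\Omega$. For $G:\Omega\to\mathbb R^{(N\times N)\times N}$ and $\zeta:\Omega\to\mathbb R^N$ consider the system $$\nabla\zeta=G\zeta\ \text{ in }\Omega,\qquad \zeta|_\Gamma=0, \tag{$*$}$$ where $G(x)$ is regarded as a linear map from $\mathbb R^N$ to $\mathbb R^{N\times N}$, $\nabla\zeta$ is the weak derivative (Jacobian matrix) of $\zeta$, and $\zeta|_\Gamma=0$ means that the trace of $\zeta$ on $\partial\Omega$ vanishes $\mathcal H^{N-1}$-almost everywhere on $\Gamma$. Here $T$ is the trace of $\zeta$ if there are functions $\varphi_n\in C^\infty(\mathbb R^N;\mathbb R^N)$ such that, for every $R>0$, $\varphi_n\to\zeta$ in $W^{1,1}(\Omega\cap B_R(0);\mathbb R^N)$ and $\varphi_n|_{\partial\Omega}\to T$ in $L^1(\partial\Omega\cap B_R(0),\mathcal H^{N-1};\mathbb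 R^N)$. 1. If $G\in L^1(\Omega;\mathbb R^{(N\times N)\times N})$ and $\zeta\in W^{1,1}(\Omega;\mathbb R^N)$ solves $(*)$, then $\zeta=0$ almost everywhere in $\Omega$. 2. In particular, $L^2$-solutions are unique when $G$ is square-integrable: if $G\in L^2(\Omega;\mathbb R^{(N\times N)\times N})$ and $\zeta\in L^2(\Omega;\mathbb R^N)$ solves $(*)$, then $\zeta=0$ almost everywhere in $\Omega$. -/

import Mathlib

open MeasureTheory Filter Topology Set
open scoped ContDiff

/-- A Lipschitz domain in `ℝ^N`: a (possibly unbounded) connected nonempty open set which near each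
of its boundary points is, for some unit vector `v`, the strict epigraph in the direction `v` of a
Lipschitz function on the hyperplane `v^⊥`. -/
structure IsLipschitzDomain {N : ℕ} (Ω : Set (EuclideanSpace ℝ (Fin N))) : Prop where
  isOpen : IsOpen Ω
  isConnected : IsConnected Ω
  exists_epigraph : ∀ x ∈ frontier Ω, ∃ U ∈ 𝓝 x, ∃ v : EuclideanSpace ℝ (Fin N), ‖v‖ = 1 ∧
    ∃ (K : NNReal) (γ : (Submodule.span ℝ {v})ᗮ → ℝ), LipschitzWith K γ ∧
      ∀ y ∈ U, (y ∈ Ω ↔ γ ((Submodule.span ℝ {v})ᗮ.orthogonalProjectionOnto y) < inner ℝ v y)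

/-- `Du` is the weak (distributional) derivative of `u` in the open set `Ω`; the matrix `∇u(x)`
(row-wise gradients) is identified with the linear map `Du x`. -/
structure HasWeakDerivOn {N : ℕ} {F : Type*} [NormedAddCommGroup F] [NormedSpace ℝ F]
    (Ω : Set (EuclideanSpace ℝ (Fin N))) (u : EuclideanSpace ℝ (Fin N) → F)
    (Du : EuclideanSpace ℝ (Fin N) → EuclideanSpace ℝ (Fin N) →L[ℝ] F) : Prop where
  locallyIntegrableOn : LocallyIntegrableOn u Ω
  locallyIntegrableOn_deriv : LocallyIntegrableOn Du Ω
  integral_eq : ∀ φ : EuclideanSpace ℝ (Fin N) → ℝ, ContDiff ℝ ∞ φ → HasCompactSupport φ →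
    tsupport φ ⊆ Ω → ∀ e : EuclideanSpace ℝ (Fin N),
      ∫ x in Ω, (fderiv ℝ φ x e) • u x = - ∫ x in Ω, φ x • Du x e

/-- The Sobolev space `W^{1,1}(Ω; F)`. -/
def MemW11 {N : ℕ} {F : Type*} [NormedAddCommGroup F] [NormedSpace ℝ F]
    (Ω : Set (EuclideanSpace ℝ (Fin N))) (u : EuclideanSpace ℝ (Fin N) → F) : Prop :=
  IntegrableOn u Ω ∧ ∃ Du, HasWeakDerivOn Ω u Du ∧ IntegrableOn Du Ω

/-- `T` is the trace on `∂Ω` of the weakly differentiable function `u`: there are smooth functions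
on `ℝ^N` which converge to `u` in `W^{1,1}(Ω ∩ B_R)` and whose restrictions to the boundary converge
to `T` in `L^1(∂Ω ∩ B_R)` with respect to the surface measure `H^{N-1}`, for every `R`. (For bounded
`Ω` these are convergences in `W^{1,1}(Ω)` and `L^1(∂Ω)`; in general the trace of a function is
only locally integrable on `∂Ω`.) -/
def HasTrace {N : ℕ} {F : Type*} [NormedAddCommGroup F] [NormedSpace ℝ F]
    (Ω : Set (EuclideanSpace ℝ (Fin N))) (u T : EuclideanSpace ℝ (Fin N) → F) : Prop :=
  AEStronglyMeasurable T ((Measure.hausdorffMeasure ((N : ℝ) - 1)).restrict (frontier Ω)) ∧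
  ∃ Du, HasWeakDerivOn Ω u Du ∧
  ∃ f : ℕ → EuclideanSpace ℝ (Fin N) → F, (∀ n, ContDiff ℝ ∞ (f n)) ∧ ∀ R : ℝ,
    Tendsto (fun n => ∫⁻ x in Ω ∩ Metric.ball 0 R, ‖f n x - u x‖ₑ) atTop (𝓝 0) ∧
    Tendsto (fun n => ∫⁻ x in Ω ∩ Metric.ball 0 R, ‖fderiv ℝ (f n) x - Du x‖ₑ) atTop (𝓝 0) ∧
    Tendsto (fun n => ∫⁻ x in frontier Ω ∩ Metric.ball 0 R, ‖f n x - T x‖ₑ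
      ∂(Measure.hausdorffMeasure ((N : ℝ) - 1))) atTop (𝓝 0)

/-- `u|_Γ = 0` in the sense of traces: the trace of `u` vanishes `H^{N-1}`-almost everywhere on the
part `Γ` of the boundary of `Ω`. -/
def TraceVanishesOn {N : ℕ} {F : Type*} [NormedAddCommGroup F] [NormedSpace ℝ F]
    (Ω Γ : Set (EuclideanSpace ℝ (Fin N))) (u : EuclideanSpace ℝ (Fin N) → F) : Prop :=
  ∃ T, HasTrace Ω u T ∧
    ∀ᵐ x ∂((Measure.hausdorffMeasure ((N : ℝ) - 1)).restrict Γ), T x = 0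

/-! Along a segment whose starting point carries the value zero, the equation gives |ζ(t)| ≤ ∫₀ᵗ
|e||G||ζ| ds, with e the direction, and Grönwall's lemma with an integrable kernel forces ζ = 0 on
the segment. Since ζ is only weakly differentiable, this inequality is derived on almost every
segment by passing to the limit in the fundamental theorem of calculus for the smooth approximants.
`ae_eq_zero_on_segments` does this for any family of parallel segments, starting where the
approximants tend to zero in L¹, that pushes the product measure to at most a multiple of Lebesgue
measure.

It is applied twice. In `IsGronwallApprox.exists_ae_eq_zero_near` the segments start on the boundary
graph inside Γ and enter Ω; the zero trace makes ζ vanish on a nonempty open subset of Ω. In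
`IsGronwallApprox.ae_eq_zero_near_segment_end` they start in a small ball where ζ already vanishes;
hence the set of points near which ζ vanishes is relatively closed in Ω, and connectedness finishes
the proof.

Only |∇ζ| ≤ |G||ζ| with |G| integrable on bounded parts of Ω is needed, so the L¹ and L² statements
have a common proof. -/

/-! ### Grönwall's lemma for an integrable kernel -/

/-- Grönwall's lemma with an integrable kernel, for nonnegative functions. -/
theorem ae_eq_zero_of_le_setLIntegral {T : ℝ} {φ D k : ℝ → ENNReal}
    (hD : ∫⁻ t in Ioc 0 T, D t ≠ ⊤) (hk : ∫⁻ t in Ioc 0 T, k t ≠ ⊤)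
    (hDk : ∀ᵐ t ∂(volume.restrict (Ioc 0 T)), D t ≤ k t * φ t)
    (hφ : ∀ᵐ t ∂(volume.restrict (Ioc 0 T)), φ t ≤ ∫⁻ s in Ioc 0 t, D s) :
    ∀ᵐ t ∂(volume.restrict (Ioc 0 T)), φ t = 0 := by
  -- Absolute continuity of the integral: `k` has mass below 1/2 on every set of measure less than
  -- `δ`. Cutting `(0, T]` into steps of length `d` turns Grönwall into a contraction on each step.
  obtain ⟨δ, hδ, hkδ⟩ := exists_pos_setLIntegral_lt_of_measure_lt hk (ε := 2⁻¹) (by simp)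
  obtain ⟨d, hd, hdδ⟩ : ∃ d : ℝ, 0 < d ∧ ENNReal.ofReal d < δ := by
    obtain ⟨d, hd, hdδ⟩ := ENNReal.lt_iff_exists_nnreal_btwn.1 hδ
    exact ⟨d, by exact_mod_cast hd, by simpa using hdδ⟩
  have key : ∀ j : ℕ, ∫⁻ s in Ioc 0 (min (j * d) T), D s = 0 := by
    intro j
    induction j with
    | zero => simp
    | succ j ih =>
      set a := min ((j : ℝ) * d) T with ha
      set b := min (((j + 1 : ℕ) : ℝ) * d) T with hb
      have hab : a ≤ b := by
        apply min_le_min_right; push_cast; nlinarith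
      have hbT : b ≤ T := min_le_right _ _
      -- `T` may be negative, and then `Ioc a b` need not lie in `Ioc 0 T`; the intersection keeps
      -- the hypotheses applicable.
      set M := ∫⁻ s in Ioc a b ∩ Ioc 0 T, D s with hM
      have hMtop : M ≠ ⊤ := ne_top_of_le_ne_top hD (lintegral_mono_set inter_subset_right)
      have hsub : Ioc 0 b ⊆ Ioc 0 a ∪ (Ioc a b ∩ Ioc 0 T) := by
        intro s hs
        by_cases h : s ≤ a
        · exact Or.inl ⟨hs.1, h⟩
        · exact Or.inr ⟨⟨not_le.1 h, hs.2⟩, hs.1, hs.2.trans hbT⟩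
      have hle : ∀ t ≤ b, ∫⁻ s in Ioc 0 t, D s ≤ M := by
        intro t ht
        calc ∫⁻ s in Ioc 0 t, D s ≤ ∫⁻ s in Ioc 0 a ∪ (Ioc a b ∩ Ioc 0 T), D s :=
              lintegral_mono_set ((Ioc_subset_Ioc_right ht).trans hsub)
          _ ≤ (∫⁻ s in Ioc 0 a, D s) + M := lintegral_union_le _ _ _
          _ = M := by rw [ih, zero_add]
      -- On the current step `φ ≤ M`, so `D ≤ M k`, and `k` has mass at most 1/2 there. As `M` is
      -- finite, it must be zero.
      have hM2 : M ≤ M * 2⁻¹ := by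
        have h1 : ∀ᵐ s ∂(volume.restrict (Ioc a b ∩ Ioc 0 T)), D s ≤ M * k s := by
          have h2 : ∀ᵐ s ∂(volume.restrict (Ioc a b ∩ Ioc 0 T)), D s ≤ k s * φ s :=
            ae_restrict_of_ae_restrict_of_subset inter_subset_right hDk
          have h3 : ∀ᵐ s ∂(volume.restrict (Ioc a b ∩ Ioc 0 T)),
              φ s ≤ ∫⁻ r in Ioc 0 s, D r :=
            ae_restrict_of_ae_restrict_of_subset inter_subset_right hφ
          filter_upwards [h2, h3, ae_restrict_mem (measurableSet_Ioc.inter measurableSet_Ioc)]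
            with s h2 h3 hs
          rw [mul_comm]
          exact h2.trans (mul_le_mul_right (h3.trans (hle s hs.1.2)) _)
        calc M ≤ ∫⁻ s in Ioc a b ∩ Ioc 0 T, M * k s := lintegral_mono_ae h1
          _ = M * ∫⁻ s in Ioc a b ∩ Ioc 0 T, k s := lintegral_const_mul' _ _ hMtop
          _ ≤ M * 2⁻¹ := by
            gcongr
            have := hkδ (Ioc a b) (by
              refine lt_of_le_of_lt (Measure.restrict_apply_le _ _) ?_
              rw [Real.volume_Ioc]
              refine lt_of_le_of_lt (ENNReal.ofReal_le_ofReal ?_) hdδ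
              rw [ha, hb, sub_le_iff_le_add]
              rcases le_total ((j : ℝ) * d) T with h | h
              · rw [min_eq_left h]
                refine (min_le_left _ _).trans (le_of_eq ?_)
                push_cast; ring
              · rw [min_eq_right h]
                exact (min_le_right _ _).trans (by linarith))
            rw [Measure.restrict_restrict measurableSet_Ioc] at this
            exact this.le
      have hM0 : M = 0 := by
        by_contra hne
        have : M * 2⁻¹ < M * 1 := by
          rw [ENNReal.mul_lt_mul_iff_right hne hMtop]
          exact ENNReal.inv_lt_one.2 (by norm_num)
        rw [mul_one] at this
        exact absurd hM2 (not_le.2 this)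
      exact le_antisymm ((hle b le_rfl).trans hM0.le) (zero_le)
  obtain ⟨j, hj⟩ := exists_nat_ge (T / d)
  have hjT : min ((j : ℝ) * d) T = T := min_eq_right (by rwa [div_le_iff₀ hd] at hj)
  have hT := key j
  rw [hjT] at hT
  filter_upwards [hφ, ae_restrict_mem measurableSet_Ioc] with t ht htm
  exact le_antisymm (ht.trans ((lintegral_mono_set (Ioc_subset_Ioc_right htm.2)).trans hT.le))
    (zero_le)

/-! ### Vanishing along almost every segment -/

/-- A sequence of nonnegative extended reals converging to `0` has a summable subsequence. -/
theorem exists_strictMono_tsum_comp_ne_top {a : ℕ → ENNReal} (ha : Tendsto a atTop (𝓝 0)) :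
    ∃ ν : ℕ → ℕ, StrictMono ν ∧ ∑' j, a (ν j) ≠ ⊤ := by
  have h : ∀ j : ℕ, ∀ᶠ n in atTop, a n ≤ 2⁻¹ ^ j := fun j =>
    (ha.eventually_lt_const (ENNReal.pow_pos (by simp) j)).mono fun _ h => h.le
  obtain ⟨ν, hν, h⟩ := extraction_forall_of_eventually' (fun j => (eventually_atTop.1 (h j)))
  refine ⟨ν, hν, ne_top_of_le_ne_top ?_ (ENNReal.tsum_le_tsum h)⟩
  rw [ENNReal.tsum_geometric]
  simp

/-- If the integrals of measurable nonnegative functions are summable, the functions converge to `0`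
almost everywhere. -/
theorem ae_tendsto_zero_of_tsum_lintegral_ne_top {α : Type*} [MeasurableSpace α] {μ : Measure α}
    {f : ℕ → α → ENNReal} (hf : ∀ n, AEMeasurable (f n) μ) (h : ∑' n, ∫⁻ x, f n x ∂μ ≠ ⊤) :
    ∀ᵐ x ∂μ, Tendsto (fun n => f n x) atTop (𝓝 0) := by
  rw [← lintegral_tsum hf] at h
  filter_upwards [ae_lt_top' (AEMeasurable.tsum hf) h] with x hx
  exact ENNReal.tendsto_atTop_zero_of_tsum_ne_top hx.ne

/-- The increment of a smooth function along a segment is bounded by the integral of its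
derivative. -/
theorem enorm_le_enorm_add_lintegral_fderiv {E F : Type*} [NormedAddCommGroup E] [NormedSpace ℝ E]
    [NormedAddCommGroup F] [NormedSpace ℝ F] [CompleteSpace F] {f : E → F} (hf : ContDiff ℝ ∞ f)
    (x e : E) {t : ℝ} (ht : 0 ≤ t) :
    ‖f (x + t • e)‖ₑ ≤ ‖f x‖ₑ + ∫⁻ s in Ioc 0 t, ‖e‖ₑ * ‖fderiv ℝ f (x + s • e)‖ₑ := by
  have hd : ∀ s ∈ uIcc 0 t, HasDerivAt (fun s : ℝ => f (x + s • e)) (fderiv ℝ f (x + s • e) e) s := by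
    intro s _
    have h1 : HasDerivAt (fun s : ℝ => x + s • e) e s := by
      simpa using ((hasDerivAt_id s).smul_const e).const_add x
    exact ((hf.differentiable (by simp)) _).hasFDerivAt.comp_hasDerivAt s h1
  have hc : Continuous fun s : ℝ => fderiv ℝ f (x + s • e) e :=
    ((hf.continuous_fderiv (by simp)).comp (by fun_prop)).clm_apply continuous_const
  have hI := intervalIntegral.integral_eq_sub_of_hasDerivAt hd (hc.intervalIntegrable _ _)
  have h2 : f (x + t • e) = f x + ∫ s in (0 : ℝ)..t, fderiv ℝ f (x + s • e) e := by
    rw [hI]; simp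
  rw [h2]
  refine (enorm_add_le _ _).trans (add_le_add_right ?_ _)
  rw [intervalIntegral.integral_of_le ht]
  refine (enorm_integral_le_lintegral_enorm _).trans (lintegral_mono fun s => ?_)
  rw [mul_comm]
  exact ContinuousLinearMap.le_opENorm _ _

/-- Let `f n` be smooth functions converging to `u` in `W^{1,1}`, with derivatives converging to
`Du`, where `|Du| ≤ g |u|` for an integrable `g`. If `f n` converges to zero on a family of base
points, then `u` vanishes almost everywhere on the segments with direction `e` starting there. -/
theorem ae_eq_zero_on_segments {E F P : Type*} [NormedAddCommGroup E] [NormedSpace ℝ E]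
    [MeasurableSpace E] [BorelSpace E] [SecondCountableTopology E]
    [NormedAddCommGroup F] [NormedSpace ℝ F] [CompleteSpace F]
    [MeasurableSpace P] {μ : Measure P} [SFinite μ] {κ : Measure E} {b : P → E}
    (hb : Measurable b) (e : E) {T : ℝ} {C : ENNReal} (hC : C ≠ ⊤)
    (hmap : (μ.prod (volume.restrict (Ioc 0 T))).map (fun q => b q.1 + q.2 • e) ≤ C • κ)
    {u : E → F} (hu : AEStronglyMeasurable u κ) {Du : E → E →L[ℝ] F}
    (hDu : AEStronglyMeasurable Du κ) (hDui : ∫⁻ x, ‖Du x‖ₑ ∂κ ≠ ⊤)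
    {g : E → ENNReal} (hg : AEMeasurable g κ) (hgi : ∫⁻ x, g x ∂κ ≠ ⊤)
    (hDg : ∀ᵐ x ∂κ, ‖Du x‖ₑ ≤ g x * ‖u x‖ₑ)
    {f : ℕ → E → F} (hf : ∀ n, ContDiff ℝ ∞ (f n))
    (hfu : Tendsto (fun n => ∫⁻ x, ‖f n x - u x‖ₑ ∂κ) atTop (𝓝 0))
    (hfD : Tendsto (fun n => ∫⁻ x, ‖fderiv ℝ (f n) x - Du x‖ₑ ∂κ) atTop (𝓝 0))
    (hfb : Tendsto (fun n => ∫⁻ p, ‖f n (b p)‖ₑ ∂μ) atTop (𝓝 0)) :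
    ∀ᵐ q ∂(μ.prod (volume.restrict (Ioc 0 T))), u (b q.1 + q.2 • e) = 0 := by
  set ν : Measure ℝ := volume.restrict (Ioc 0 T) with hν
  set Ψ : P × ℝ → E := fun q => b q.1 + q.2 • e with hΨ
  have hΨm : Measurable Ψ := (hb.comp measurable_fst).add (measurable_snd.smul_const e)
  have hq : Measure.QuasiMeasurePreserving Ψ (μ.prod ν) κ :=
    ⟨hΨm, (Measure.absolutelyContinuous_of_le hmap).trans
      (Measure.absolutelyContinuous_of_le_smul (c := C) le_rfl)⟩
  have hm : ∀ {h : E → ENNReal}, AEMeasurable h κ → AEMeasurable (fun q => h (Ψ q)) (μ.prod ν) :=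
    fun hh => hh.comp_quasiMeasurePreserving hq
  have hi : ∀ {h : E → ENNReal}, AEMeasurable h κ →
      ∫⁻ q, h (Ψ q) ∂(μ.prod ν) ≤ C * ∫⁻ x, h x ∂κ := by
    intro h hh
    rw [← lintegral_map' (hh.mono_ac hq.absolutelyContinuous) hΨm.aemeasurable]
    refine (lintegral_mono' hmap le_rfl).trans ?_
    rw [lintegral_smul_measure, smul_eq_mul]
  have hfc : ∀ n, Continuous (f n) := fun n => (hf n).continuous
  have hfdc : ∀ n, Continuous (fderiv ℝ (f n)) := fun n => (hf n).continuous_fderiv (by simp)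
  have mA : ∀ n, AEMeasurable (fun x => ‖f n x - u x‖ₑ) κ := fun n =>
    ((hfc n).aestronglyMeasurable.sub hu).enorm
  have mB : ∀ n, AEMeasurable (fun x => ‖fderiv ℝ (f n) x - Du x‖ₑ) κ := fun n =>
    ((hfdc n).aestronglyMeasurable.sub hDu).enorm
  have mC : ∀ n, AEMeasurable (fun p => ‖f n (b p)‖ₑ) μ := fun n =>
    ((hfc n).enorm.measurable.comp hb).aemeasurable
  -- The subsequence is extracted for the sum of the three errors, so that one `σ` serves interior
  -- values, derivatives and base values.
  obtain ⟨σ, hσ, hsum⟩ := exists_strictMono_tsum_comp_ne_top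
    (by simpa using (hfu.add hfD).add hfb)
  have hsA : ∑' n, ∫⁻ x, ‖f (σ n) x - u x‖ₑ ∂κ ≠ ⊤ :=
    ne_top_of_le_ne_top hsum (ENNReal.tsum_le_tsum fun n => by
      rw [add_assoc]; exact le_self_add)
  have hsB : ∑' n, ∫⁻ x, ‖fderiv ℝ (f (σ n)) x - Du x‖ₑ ∂κ ≠ ⊤ :=
    ne_top_of_le_ne_top hsum (ENNReal.tsum_le_tsum fun n => by
      rw [add_right_comm]; exact le_add_self)
  have hsC : ∑' n, ∫⁻ p, ‖f (σ n) (b p)‖ₑ ∂μ ≠ ⊤ :=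
    ne_top_of_le_ne_top hsum (ENNReal.tsum_le_tsum fun n => le_add_self)
  have hmul : ∀ {a c : ℕ → ENNReal}, (∀ n, a n ≤ C * c n) → ∑' n, c n ≠ ⊤ → ∑' n, a n ≠ ⊤ := by
    intro a c hac hc
    refine ne_top_of_le_ne_top ?_ (ENNReal.tsum_le_tsum hac)
    rw [ENNReal.tsum_mul_left]
    exact ENNReal.mul_ne_top hC hc
  have tA := Measure.ae_ae_of_ae_prod (ae_tendsto_zero_of_tsum_lintegral_ne_top
    (fun n => hm (mA (σ n))) (hmul (fun n => hi (mA (σ n))) hsA))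
  have tB : ∀ᵐ p ∂μ, Tendsto (fun n => ∫⁻ t, ‖fderiv ℝ (f (σ n)) (Ψ (p, t)) - Du (Ψ (p, t))‖ₑ ∂ν)
      atTop (𝓝 0) := by
    refine ae_tendsto_zero_of_tsum_lintegral_ne_top
      (fun n => (hm (mB (σ n))).lintegral_prod_right') (hmul (fun n => ?_) hsB)
    rw [← lintegral_prod _ (hm (mB (σ n)))]
    exact hi (mB (σ n))
  have tC := ae_tendsto_zero_of_tsum_lintegral_ne_top (fun n => mC (σ n)) hsC
  have fin : ∀ {h : E → ENNReal}, AEMeasurable h κ → ∫⁻ x, h x ∂κ ≠ ⊤ →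
      ∀ᵐ p ∂μ, ∫⁻ t, h (Ψ (p, t)) ∂ν ≠ ⊤ := by
    intro h hh hht
    have := (hi hh).trans_lt (ENNReal.mul_lt_top hC.lt_top hht.lt_top)
    rw [lintegral_prod _ (hm hh)] at this
    filter_upwards [ae_lt_top' (hm hh).lintegral_prod_right' this.ne] with p hp using hp.ne
  have hDgp := Measure.ae_ae_of_ae_prod (hq.ae hDg)
  -- A measurable representative on the product has measurable slices, and agrees with the original
  -- on almost every slice.
  have hDm : ∀ᵐ p ∂μ, AEMeasurable (fun t => ‖Du (Ψ (p, t))‖ₑ) ν := by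
    filter_upwards [Measure.ae_ae_of_ae_prod (hm hDu.enorm).ae_eq_mk] with p hp
    exact ⟨_, (hm hDu.enorm).measurable_mk.comp measurable_prodMk_left, hp⟩
  have main : ∀ᵐ p ∂μ, ∀ᵐ t ∂ν, ‖u (Ψ (p, t))‖ₑ = 0 := by
    filter_upwards [tA, tB, tC, fin hDu.enorm hDui, fin hg hgi, hDgp, hDm]
      with p tA tB tC fD fg hDg hDm
    refine ae_eq_zero_of_le_setLIntegral (D := fun t => ‖e‖ₑ * ‖Du (Ψ (p, t))‖ₑ)
      (k := fun t => ‖e‖ₑ * g (Ψ (p, t))) ?_ ?_ ?_ ?_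
    · rw [lintegral_const_mul' _ _ enorm_ne_top]
      exact ENNReal.mul_ne_top enorm_ne_top fD
    · rw [lintegral_const_mul' _ _ enorm_ne_top]
      exact ENNReal.mul_ne_top enorm_ne_top fg
    · filter_upwards [hDg] with t ht
      rw [mul_assoc]
      gcongr
    · filter_upwards [tA, ae_restrict_mem measurableSet_Ioc] with t tA ht
      -- The three bracketed terms tend to zero, leaving |u(t)| ≤ ∫₀ᵗ |e||Du|, the integral
      -- inequality required by Grönwall's lemma.
      have hbd : ∀ n, ‖u (Ψ (p, t))‖ₑ ≤ (‖f (σ n) (Ψ (p, t)) - u (Ψ (p, t))‖ₑ + ‖f (σ n) (b p)‖ₑ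
          + ‖e‖ₑ * ∫⁻ t, ‖fderiv ℝ (f (σ n)) (Ψ (p, t)) - Du (Ψ (p, t))‖ₑ ∂ν) +
          ∫⁻ s in Ioc 0 t, ‖e‖ₑ * ‖Du (Ψ (p, s))‖ₑ := by
        intro n
        have h1 : ‖u (Ψ (p, t))‖ₑ ≤ ‖f (σ n) (Ψ (p, t)) - u (Ψ (p, t))‖ₑ + ‖f (σ n) (Ψ (p, t))‖ₑ := by
          rw [← enorm_neg (f (σ n) (Ψ (p, t)) - u (Ψ (p, t)))]
          refine le_trans (le_of_eq ?_) (enorm_add_le _ _)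
          congr 1; abel
        have h2 := enorm_le_enorm_add_lintegral_fderiv (hf (σ n)) (b p) e ht.1.le
        have h3 : ∫⁻ s in Ioc 0 t, ‖e‖ₑ * ‖fderiv ℝ (f (σ n)) (b p + s • e)‖ₑ ≤
            ‖e‖ₑ * (∫⁻ t, ‖fderiv ℝ (f (σ n)) (Ψ (p, t)) - Du (Ψ (p, t))‖ₑ ∂ν) +
              ∫⁻ s in Ioc 0 t, ‖e‖ₑ * ‖Du (Ψ (p, s))‖ₑ := by
          rw [lintegral_const_mul' _ _ enorm_ne_top, lintegral_const_mul' _ _ enorm_ne_top,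
            ← mul_add]
          gcongr
          have hsub : Ioc 0 t ⊆ Ioc 0 T := Ioc_subset_Ioc_right ht.2
          calc ∫⁻ s in Ioc 0 t, ‖fderiv ℝ (f (σ n)) (b p + s • e)‖ₑ
              ≤ ∫⁻ s in Ioc 0 t, (‖fderiv ℝ (f (σ n)) (Ψ (p, s)) - Du (Ψ (p, s))‖ₑ +
                  ‖Du (Ψ (p, s))‖ₑ) := lintegral_mono fun s => by
                simpa [hΨ] using enorm_add_le (fderiv ℝ (f (σ n)) (Ψ (p, s)) - Du (Ψ (p, s)))
                  (Du (Ψ (p, s)))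
            _ = _ := lintegral_add_right' _ (hDm.mono_measure (Measure.restrict_mono_set _ hsub))
            _ ≤ _ := add_le_add_left (lintegral_mono_set hsub) _
        calc _ ≤ _ := h1
          _ ≤ _ := add_le_add_right (h2.trans (add_le_add_right h3 _)) _
          _ = _ := by ring
      have hlim : Tendsto (fun n => (‖f (σ n) (Ψ (p, t)) - u (Ψ (p, t))‖ₑ + ‖f (σ n) (b p)‖ₑ
          + ‖e‖ₑ * ∫⁻ t, ‖fderiv ℝ (f (σ n)) (Ψ (p, t)) - Du (Ψ (p, t))‖ₑ ∂ν) +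
          ∫⁻ s in Ioc 0 t, ‖e‖ₑ * ‖Du (Ψ (p, s))‖ₑ) atTop
          (𝓝 (∫⁻ s in Ioc 0 t, ‖e‖ₑ * ‖Du (Ψ (p, s))‖ₑ)) := by
        have htB := ENNReal.Tendsto.const_mul tB (Or.inr (enorm_ne_top (x := e)))
        simpa using ((tA.add tC).add htB).add_const (∫⁻ s in Ioc 0 t, ‖e‖ₑ * ‖Du (Ψ (p, s))‖ₑ)
      exact ge_of_tendsto' hlim hbd
  have hint : ∫⁻ q, ‖u (Ψ q)‖ₑ ∂(μ.prod ν) = 0 := by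
    rw [lintegral_prod _ (hm hu.enorm), lintegral_eq_zero_iff' (hm hu.enorm).lintegral_prod_right']
    filter_upwards [main] with p hp
    exact lintegral_eq_zero_of_ae_eq_zero hp
  rw [lintegral_eq_zero_iff' (hm hu.enorm)] at hint
  filter_upwards [hint] with q hq
  simpa using hq

/-! ### Uniqueness of weak derivatives -/

/-- The weak derivative is unique. -/
theorem HasWeakDerivOn.ae_eq {N : ℕ} {F : Type*} [NormedAddCommGroup F] [NormedSpace ℝ F]
    [CompleteSpace F] {Ω : Set (EuclideanSpace ℝ (Fin N))} (hΩ : IsOpen Ω)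
    {u : EuclideanSpace ℝ (Fin N) → F}
    {D₁ D₂ : EuclideanSpace ℝ (Fin N) → EuclideanSpace ℝ (Fin N) →L[ℝ] F}
    (h₁ : HasWeakDerivOn Ω u D₁) (h₂ : HasWeakDerivOn Ω u D₂) :
    D₁ =ᵐ[volume.restrict Ω] D₂ := by
  have apply_e : ∀ {D : EuclideanSpace ℝ (Fin N) → EuclideanSpace ℝ (Fin N) →L[ℝ] F}
      (_ : LocallyIntegrableOn D Ω) (e : EuclideanSpace ℝ (Fin N)),
      LocallyIntegrableOn (fun x => D x e) Ω := by
    intro D hD e x hx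
    obtain ⟨s, hs, hi⟩ := hD x hx
    exact ⟨s, hs, (ContinuousLinearMap.apply ℝ F e).integrable_comp hi⟩
  have hint : ∀ {h : EuclideanSpace ℝ (Fin N) → F} (_ : LocallyIntegrableOn h Ω)
      {φ : EuclideanSpace ℝ (Fin N) → ℝ} (_ : Continuous φ) (_ : HasCompactSupport φ)
      (_ : tsupport φ ⊆ Ω), Integrable (fun x => φ x • h x) := by
    intro h hh φ hφ hc hs
    have h1 : IntegrableOn (fun x => φ x • h x) (tsupport φ) :=
      (hh.integrableOn_compact_subset hs hc).continuousOn_smul hφ.continuousOn hc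
    rwa [integrableOn_iff_integrable_of_support_subset] at h1
    exact (Function.support_smul_subset_left _ _).trans (subset_tsupport _)
  have key : ∀ e, ∀ᵐ x ∂(volume.restrict Ω), D₁ x e = D₂ x e := by
    intro e
    have l1 := apply_e h₁.locallyIntegrableOn_deriv e
    have l2 := apply_e h₂.locallyIntegrableOn_deriv e
    have := hΩ.ae_eq_zero_of_integral_contDiff_smul_eq_zero (μ := volume)
      (f := fun x => D₁ x e - D₂ x e) (l1.sub l2) (fun φ hφ hc hs => by
        have i1 := hint l1 hφ.continuous hc hs
        have i2 := hint l2 hφ.continuous hc hs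
        have e1 := h₁.integral_eq φ hφ hc hs e
        rw [h₂.integral_eq φ hφ hc hs e, neg_inj] at e1
        have hz : ∀ (h : EuclideanSpace ℝ (Fin N) → F), ∀ x ∉ Ω, φ x • h x = 0 := by
          intro h x hx
          rw [image_eq_zero_of_notMem_tsupport (fun hx' => hx (hs hx')), zero_smul]
        rw [setIntegral_eq_integral_of_forall_compl_eq_zero (hz _),
          setIntegral_eq_integral_of_forall_compl_eq_zero (hz _)] at e1
        simp_rw [smul_sub]
        rw [integral_sub i1 i2, e1, sub_self])
    rw [ae_restrict_iff' hΩ.measurableSet]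
    filter_upwards [this] with x hx hxΩ using sub_eq_zero.1 (hx hxΩ)
  -- The exceptional null set depends on the direction; finitely many basis directions determine the
  -- linear map.
  have hall : ∀ᵐ x ∂(volume.restrict Ω), ∀ i, D₁ x (EuclideanSpace.basisFun (Fin N) ℝ i) =
      D₂ x (EuclideanSpace.basisFun (Fin N) ℝ i) := ae_all_iff.2 fun i => key _
  filter_upwards [hall] with x hx
  refine ContinuousLinearMap.coe_injective
    ((EuclideanSpace.basisFun (Fin N) ℝ).toBasis.ext fun i => ?_)
  simpa using hx i

/-! ### Propagation of zeros inside the domain -/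

/-- `f` is a sequence of smooth functions converging locally up to the boundary in `W^{1,1}(Ω)` to
a function `u` whose derivative `Du` satisfies `|Du| ≤ g |u|` with `g` locally integrable up to the
boundary. -/
structure IsGronwallApprox {N : ℕ} {F : Type*} [NormedAddCommGroup F] [NormedSpace ℝ F]
    (Ω : Set (EuclideanSpace ℝ (Fin N))) (u : EuclideanSpace ℝ (Fin N) → F)
    (Du : EuclideanSpace ℝ (Fin N) → EuclideanSpace ℝ (Fin N) →L[ℝ] F)
    (g : EuclideanSpace ℝ (Fin N) → ENNReal) (f : ℕ → EuclideanSpace ℝ (Fin N) → F) : Prop where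
  aesm : AEStronglyMeasurable u (volume.restrict Ω)
  aesm_deriv : AEStronglyMeasurable Du (volume.restrict Ω)
  aemeasurable : AEMeasurable g (volume.restrict Ω)
  lintegral_ne_top : ∀ R, ∫⁻ x in Ω ∩ Metric.ball 0 R, g x ≠ ⊤
  bound : ∀ᵐ x ∂(volume.restrict Ω), ‖Du x‖ₑ ≤ g x * ‖u x‖ₑ
  contDiff : ∀ n, ContDiff ℝ ∞ (f n)
  tendsto : ∀ R, Tendsto (fun n => ∫⁻ x in Ω ∩ Metric.ball 0 R, ‖f n x - u x‖ₑ) atTop (𝓝 0)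
  tendsto_deriv : ∀ R, Tendsto (fun n => ∫⁻ x in Ω ∩ Metric.ball 0 R,
    ‖fderiv ℝ (f n) x - Du x‖ₑ) atTop (𝓝 0)

namespace IsGronwallApprox

variable {N : ℕ} {F : Type*} [NormedAddCommGroup F] [NormedSpace ℝ F]
  {Ω : Set (EuclideanSpace ℝ (Fin N))} {u : EuclideanSpace ℝ (Fin N) → F}
  {Du : EuclideanSpace ℝ (Fin N) → EuclideanSpace ℝ (Fin N) →L[ℝ] F}
  {g : EuclideanSpace ℝ (Fin N) → ENNReal} {f : ℕ → EuclideanSpace ℝ (Fin N) → F}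

/-- A weak derivative is assumed integrable only locally inside `Ω`. Integrability up to the
boundary comes from one approximant at finite L¹ distance, whose derivative is continuous and so
integrable on a closed ball. -/
theorem lintegral_deriv_ne_top (h : IsGronwallApprox Ω u Du g f) (R : ℝ) :
    ∫⁻ x in Ω ∩ Metric.ball 0 R, ‖Du x‖ₑ ≠ ⊤ := by
  obtain ⟨n, hn⟩ := ((h.tendsto_deriv R).eventually_lt_const ENNReal.zero_lt_top).exists
  have hc : Continuous (fderiv ℝ (f n)) := (h.contDiff n).continuous_fderiv (by simp)
  have h1 : ∫⁻ x in Ω ∩ Metric.ball 0 R, ‖fderiv ℝ (f n) x‖ₑ ≠ ⊤ := by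
    have : IntegrableOn (fderiv ℝ (f n)) (Metric.closedBall 0 R) :=
      hc.continuousOn.integrableOn_compact (isCompact_closedBall _ _)
    exact (this.mono_set (inter_subset_right.trans Metric.ball_subset_closedBall)).2.ne
  refine ne_top_of_le_ne_top (ENNReal.add_ne_top.2 ⟨hn.ne, h1⟩) ?_
  rw [← lintegral_add_right _ hc.enorm.measurable]
  refine lintegral_mono fun x => ?_
  have := enorm_sub_le (a := fderiv ℝ (f n) x) (b := fderiv ℝ (f n) x - Du x)
  rw [sub_sub_cancel, add_comm] at this
  exact this

variable [CompleteSpace F]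

theorem ae_eq_zero_on_segments (h : IsGronwallApprox Ω u Du g f) {P : Type*} [MeasurableSpace P]
    {μ : Measure P} [SFinite μ] {b : P → EuclideanSpace ℝ (Fin N)} (hb : Measurable b)
    (e : EuclideanSpace ℝ (Fin N)) {T R : ℝ} {C : ENNReal} (hC : C ≠ ⊤)
    (hmap : (μ.prod (volume.restrict (Ioc 0 T))).map (fun q => b q.1 + q.2 • e) ≤
      C • volume.restrict (Ω ∩ Metric.ball 0 R))
    (hfb : Tendsto (fun n => ∫⁻ p, ‖f n (b p)‖ₑ ∂μ) atTop (𝓝 0)) :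
    ∀ᵐ q ∂(μ.prod (volume.restrict (Ioc 0 T))), u (b q.1 + q.2 • e) = 0 := by
  have hle : volume.restrict (Ω ∩ Metric.ball 0 R) ≤ volume.restrict Ω :=
    Measure.restrict_mono_set _ inter_subset_left
  exact _root_.ae_eq_zero_on_segments hb e hC hmap (h.aesm.mono_measure hle)
    (h.aesm_deriv.mono_measure hle) (h.lintegral_deriv_ne_top R) (h.aemeasurable.mono_measure hle)
    (h.lintegral_ne_top R) (ae_mono hle h.bound) h.contDiff (h.tendsto R) (h.tendsto_deriv R) hfb

/-- Vanishing near a point propagates along segments contained in the domain. -/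
theorem ae_eq_zero_near_segment_end (h : IsGronwallApprox Ω u Du g f) (hΩ : IsOpen Ω)
    {x e : EuclideanSpace ℝ (Fin N)} (hseg : ∀ t ∈ Icc (0 : ℝ) 1, x + t • e ∈ Ω)
    {W : Set (EuclideanSpace ℝ (Fin N))} (hW : W ∈ 𝓝 x)
    (hu : ∀ᵐ z ∂(volume.restrict W), u z = 0) :
    ∃ W' ∈ 𝓝 (x + e), ∀ᵐ z ∂(volume.restrict W'), u z = 0 := by
  have hK : IsCompact ((fun t : ℝ => x + t • e) '' Icc 0 1) :=
    isCompact_Icc.image (by fun_prop)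
  obtain ⟨δ₁, hδ₁, hthick⟩ := hK.exists_thickening_subset_open hΩ (by
    rintro _ ⟨t, ht, rfl⟩; exact hseg t ht)
  obtain ⟨δ₂, hδ₂, hball⟩ := Metric.mem_nhds_iff.1 hW
  set δ := min δ₁ δ₂ with hδdef
  have hδ : 0 < δ := lt_min hδ₁ hδ₂
  set A := Metric.ball x δ with hA
  have hAW : A ⊆ W := (Metric.ball_subset_ball (min_le_right _ _)).trans hball
  set R := ‖x‖ + ‖e‖ + δ with hR
  have hmem : ∀ z ∈ A, ∀ t ∈ Icc (0 : ℝ) 1, z + t • e ∈ Ω ∩ Metric.ball 0 R := by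
    intro z hz t ht
    refine ⟨hthick (Metric.mem_thickening_iff.2 ⟨x + t • e, ⟨t, ht, rfl⟩, ?_⟩), ?_⟩
    · rw [dist_add_right]
      exact lt_of_lt_of_le hz (min_le_left _ _)
    · rw [mem_ball_zero_iff]
      have h1 : ‖t • e‖ ≤ ‖e‖ := by
        rw [norm_smul, Real.norm_of_nonneg ht.1]
        exact mul_le_of_le_one_left (norm_nonneg _) ht.2
      have h2 : ‖z‖ ≤ ‖x‖ + ‖z - x‖ := norm_le_norm_add_norm_sub' z x
      have h3 : ‖z - x‖ < δ := by rw [← dist_eq_norm]; exact hz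
      linarith [norm_add_le z (t • e)]
  have hAΩ : A ⊆ Ω ∩ Metric.ball 0 R := fun z hz => by
    simpa using hmem z hz 0 (by simp)
  -- For fixed `t` the map is a translation carrying `A` into `Ω ∩ ball 0 R`; integrating over `t`
  -- in an interval of length 1 gives the constant 1.
  have hmap : ((volume.restrict A).prod (volume.restrict (Ioc (0 : ℝ) 1))).map
      (fun q => id q.1 + q.2 • e) ≤ (1 : ENNReal) • volume.restrict (Ω ∩ Metric.ball 0 R) := by
    have hm : Measurable fun q : EuclideanSpace ℝ (Fin N) × ℝ => id q.1 + q.2 • e :=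
      measurable_fst.add (measurable_snd.smul_const e)
    rw [one_smul]
    refine Measure.le_iff.2 fun S hS => ?_
    rw [Measure.map_apply hm hS, Measure.prod_apply_symm (hm hS), Measure.restrict_apply hS]
    calc ∫⁻ t in Ioc (0 : ℝ) 1, volume.restrict A
          ((fun z => (z, t)) ⁻¹' ((fun q => id q.1 + q.2 • e) ⁻¹' S))
        ≤ ∫⁻ t in Ioc (0 : ℝ) 1, volume (S ∩ (Ω ∩ Metric.ball 0 R)) := by
          refine setLIntegral_mono measurable_const fun t ht => ?_
          rw [← measure_preimage_add_right volume (t • e) (S ∩ _),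
            Measure.restrict_apply' measurableSet_ball]
          refine measure_mono ?_
          rintro z ⟨hz, hzA⟩
          exact ⟨hz, hmem z hzA t ⟨ht.1.le, ht.2⟩⟩
      _ = _ := by simp
  have hfb : Tendsto (fun n => ∫⁻ z in A, ‖f n (id z)‖ₑ) atTop (𝓝 0) := by
    refine tendsto_of_tendsto_of_tendsto_of_le_of_le tendsto_const_nhds (h.tendsto R)
      (fun _ => zero_le) (fun n => ?_)
    refine le_trans (le_of_eq (lintegral_congr_ae ?_))
      (lintegral_mono_set (f := fun z => ‖f n z - u z‖ₑ) hAΩ)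
    filter_upwards [ae_restrict_of_ae_restrict_of_subset hAW hu] with z hz
    simp [hz]
  have hz := h.ae_eq_zero_on_segments measurable_id e ENNReal.one_ne_top hmap hfb
  have hz' := Measure.ae_ae_of_ae_prod (Measure.measurePreserving_swap.quasiMeasurePreserving.ae hz)
  -- Vanishing on `A + t • e` is known only for almost every `t`, so `t = 1` may be unavailable. Any
  -- `t` within `η` of 1 will do, because `A + t • e` is then still a neighbourhood of `x + e`. The
  -- `+ 1` in the denominator covers `e = 0`.
  obtain ⟨η, hη, hη1, hηδ⟩ : ∃ η : ℝ, 0 < η ∧ η ≤ 1 ∧ η * ‖e‖ < δ := by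
    refine ⟨min 1 (δ / (2 * (‖e‖ + 1))), by positivity, min_le_left _ _, ?_⟩
    calc min 1 (δ / (2 * (‖e‖ + 1))) * ‖e‖ ≤ (δ / (2 * (‖e‖ + 1))) * (‖e‖ + 1) := by
          gcongr
          · exact min_le_right _ _
          · linarith
      _ = δ / 2 := by field_simp
      _ < δ := by linarith
  obtain ⟨t, ht, hzt⟩ := Measure.exists_mem_of_measure_ne_zero_of_ae
    (s := Ioo (1 - η) 1) (by simp [hη])
    (ae_restrict_of_ae_restrict_of_subset
      (show Ioo (1 - η) 1 ⊆ Ioc (0 : ℝ) 1 from fun s hs => ⟨by linarith [hs.1], hs.2.le⟩) hz')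
  refine ⟨(fun z => z - t • e) ⁻¹' A, ?_, ?_⟩
  · refine (Metric.isOpen_ball.preimage (by fun_prop)).mem_nhds ?_
    rw [mem_preimage, mem_ball_iff_norm,
      show x + e - t • e - x = (1 - t) • e by rw [sub_smul, one_smul]; abel, norm_smul,
      Real.norm_of_nonneg (by linarith [ht.2])]
    refine lt_of_le_of_lt ?_ hηδ
    gcongr
    linarith [ht.1]
  · have hmp := (measurePreserving_sub_right volume (t • e)).restrict_preimage
      (measurableSet_ball (x := x) (ε := δ))
    filter_upwards [hmp.quasiMeasurePreserving.ae hzt] with z hz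
    simpa using hz

/-- Unique continuation: vanishing near one point of a domain implies vanishing everywhere. -/
theorem ae_eq_zero_of_ae_eq_zero_near (h : IsGronwallApprox Ω u Du g f) (hΩ : IsOpen Ω)
    (hconn : IsPreconnected Ω) {x₀ : EuclideanSpace ℝ (Fin N)} (hx₀ : x₀ ∈ Ω)
    {W : Set (EuclideanSpace ℝ (Fin N))} (hW : W ∈ 𝓝 x₀)
    (hu : ∀ᵐ z ∂(volume.restrict W), u z = 0) :
    ∀ᵐ z ∂(volume.restrict Ω), u z = 0 := by
  set Z := {x | ∃ W ∈ 𝓝 x, ∀ᵐ z ∂(volume.restrict W), u z = 0} with hZ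
  have hZo : IsOpen Z := by
    refine isOpen_iff_mem_nhds.2 ?_
    rintro x ⟨W, hW, hu⟩
    filter_upwards [eventually_mem_nhds_iff.2 hW] with y hy using ⟨W, hy, hu⟩
  have hsub : Ω ⊆ Z := by
    -- A limit point of `Z` in `Ω` is the centre of a ball inside `Ω` that contains a point of `Z`;
    -- the segment between the two stays in the ball and carries the vanishing to the centre.
    refine hconn.subset_of_closure_inter_subset hZo ⟨x₀, hx₀, W, hW, hu⟩ ?_
    rintro y ⟨hyZ, hyΩ⟩
    obtain ⟨r, hr, hball⟩ := Metric.isOpen_iff.1 hΩ y hyΩ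
    obtain ⟨x, ⟨W, hW, hu⟩, hxy⟩ := Metric.mem_closure_iff.1 hyZ r hr
    have := h.ae_eq_zero_near_segment_end hΩ (x := x) (e := y - x) (fun t ht => hball
      ((convex_ball y r).add_smul_sub_mem (by rwa [Metric.mem_ball, dist_comm])
        (Metric.mem_ball_self hr) ht)) hW hu
    rw [add_sub_cancel] at this
    exact this
  rw [ae_restrict_iff' hΩ.measurableSet, ae_iff]
  refine measure_null_of_locally_null _ fun x hx => ?_
  simp only [mem_ofPred_eq, Classical.not_imp] at hx
  obtain ⟨W, hW, hu⟩ := hsub hx.1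
  obtain ⟨V, hVW, hV, hxV⟩ := mem_nhds_iff.1 hW
  refine ⟨V ∩ {z | ¬(z ∈ Ω → u z = 0)},
    inter_mem (mem_nhdsWithin_of_mem_nhds (hV.mem_nhds hxV)) self_mem_nhdsWithin, ?_⟩
  have := ae_restrict_of_ae_restrict_of_subset hVW hu
  rw [ae_restrict_iff' hV.measurableSet, ae_iff] at this
  refine measure_mono_null ?_ this
  rintro z ⟨hzV, hz⟩ hz'
  exact hz fun _ => hz' hzV

end IsGronwallApprox

/-! ### Straightening a graph over a hyperplane -/

section Epigraph

variable {E : Type*} [NormedAddCommGroup E] [InnerProductSpace ℝ E] {v : E}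

theorem orthogonalProjectionOnto_add_smul (y : (Submodule.span ℝ {v})ᗮ) (s : ℝ) :
    (Submodule.span ℝ {v})ᗮ.orthogonalProjectionOnto (y + s • v) = y := by
  rw [map_add, map_smul, Submodule.orthogonalProjectionOnto_mem_subspace_eq_self,
    Submodule.orthogonalProjectionOnto_orthogonalComplement_singleton_eq_zero, smul_zero, add_zero]

theorem inner_add_smul_eq (hv : ‖v‖ = 1) (y : (Submodule.span ℝ {v})ᗮ) (s : ℝ) :
    inner ℝ v ((y : E) + s • v) = s := by
  rw [inner_add_right, Submodule.mem_orthogonal_singleton_iff_inner_right.1 y.2, inner_smul_right,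
    real_inner_self_eq_norm_sq, hv]
  simp

theorem orthogonalProjectionOnto_add_inner_smul (hv : ‖v‖ = 1) (x : E) :
    ((Submodule.span ℝ {v})ᗮ.orthogonalProjectionOnto x : E) + inner ℝ v x • v = x := by
  have h := Submodule.starProjection_add_starProjection_orthogonal (K := Submodule.span ℝ {v}) x
  rw [Submodule.starProjection_unit_singleton ℝ hv, add_comm] at h
  exact h

/-- The homeomorphism which straightens the graph of `γ` in the direction `v`. -/
noncomputable def graphHomeomorph (hv : ‖v‖ = 1) {γ : (Submodule.span ℝ {v})ᗮ → ℝ}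
    (hγ : Continuous γ) : (Submodule.span ℝ {v})ᗮ × ℝ ≃ₜ E where
  toFun q := q.1 + (γ q.1 + q.2) • v
  invFun x := ((Submodule.span ℝ {v})ᗮ.orthogonalProjectionOnto x,
    inner ℝ v x - γ ((Submodule.span ℝ {v})ᗮ.orthogonalProjectionOnto x))
  left_inv q := by
    simp only [orthogonalProjectionOnto_add_smul, inner_add_smul_eq hv]
    ext <;> simp
  right_inv x := by
    simp only [add_sub_cancel]
    exact orthogonalProjectionOnto_add_inner_smul hv x
  continuous_toFun := by fun_prop
  continuous_invFun := by fun_prop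

variable [FiniteDimensional ℝ E] [MeasurableSpace E] [BorelSpace E]

/-- The linear equivalence `v^⊥ × ℝ ≃ E`. -/
noncomputable def orthogonalProdEquiv (hv : ‖v‖ = 1) : ((Submodule.span ℝ {v})ᗮ × ℝ) ≃ₗ[ℝ] E where
  toFun q := q.1 + q.2 • v
  map_add' p q := by simp only [Prod.fst_add, Prod.snd_add, Submodule.coe_add, add_smul]; abel
  map_smul' c q := by simp [mul_smul]
  invFun x := ((Submodule.span ℝ {v})ᗮ.orthogonalProjectionOnto x, inner ℝ v x)
  left_inv q := by
    simp only [orthogonalProjectionOnto_add_smul, inner_add_smul_eq hv]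
  right_inv x := orthogonalProjectionOnto_add_inner_smul hv x

/-- Straightening a graph preserves Haar measures up to a constant. -/
theorem exists_map_graphHomeomorph_eq_smul (hv : ‖v‖ = 1) {γ : (Submodule.span ℝ {v})ᗮ → ℝ}
    (hγ : Continuous γ) (m : Measure (Submodule.span ℝ {v})ᗮ) [m.IsAddHaarMeasure] (μ : Measure E)
    [μ.IsAddHaarMeasure] :
    ∃ c : ENNReal, c ≠ 0 ∧ c ≠ ⊤ ∧
      (m.prod (volume : Measure ℝ)).map (graphHomeomorph hv hγ) = c • μ := by
  set L := (orthogonalProdEquiv hv).toContinuousLinearEquiv with hL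
  -- The straightening map is a shear followed by a linear isomorphism. The shear translates each
  -- fibre, so it preserves the product measure; the isomorphism sends Haar measure to Haar measure,
  -- unique up to a positive finite factor.
  have hshear : MeasurePreserving (fun q : (Submodule.span ℝ {v})ᗮ × ℝ => (q.1, γ q.1 + q.2))
      (m.prod volume) (m.prod volume) :=
    (MeasurePreserving.id m).skew_product (g := fun y t => γ y + t)
      (by fun_prop) (ae_of_all _ fun y => map_add_left_eq_self volume (γ y))
  have hcomp : (graphHomeomorph hv hγ : (Submodule.span ℝ {v})ᗮ × ℝ → E) =
      L ∘ fun q => (q.1, γ q.1 + q.2) := rfl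
  have hHaar : ((m.prod volume).map L).IsAddHaarMeasure :=
    L.isAddHaarMeasure_map _
  refine ⟨Measure.addHaarScalarFactor ((m.prod volume).map L) μ, ?_, ENNReal.coe_ne_top, ?_⟩
  · exact_mod_cast (Measure.addHaarScalarFactor_pos_of_isAddHaarMeasure _ _).ne'
  · rw [hcomp, ← Measure.map_map L.continuous.measurable hshear.measurable, hshear.map_eq]
    exact Measure.isAddLeftInvariant_eq_smul _ _

end Epigraph

/-! ### Vanishing next to the boundary portion -/

/-- If the approximating functions converge to zero on a relatively open part of the boundary of a
Lipschitz domain, then the limit vanishes on a nonempty open subset of the domain. -/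
theorem IsGronwallApprox.exists_ae_eq_zero_near {N : ℕ} {F : Type*} [NormedAddCommGroup F]
    [NormedSpace ℝ F] [CompleteSpace F]
    {Ω : Set (EuclideanSpace ℝ (Fin N))} {u : EuclideanSpace ℝ (Fin N) → F}
    {Du : EuclideanSpace ℝ (Fin N) → EuclideanSpace ℝ (Fin N) →L[ℝ] F}
    {g : EuclideanSpace ℝ (Fin N) → ENNReal} {f : ℕ → EuclideanSpace ℝ (Fin N) → F}
    (h : IsGronwallApprox Ω u Du g f) (hΩ : IsLipschitzDomain Ω)
    {V : Set (EuclideanSpace ℝ (Fin N))} (hV : IsOpen V) {x₀ : EuclideanSpace ℝ (Fin N)}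
    (hx₀V : x₀ ∈ V) (hx₀ : x₀ ∈ frontier Ω)
    (hf : ∀ R, Tendsto (fun n => ∫⁻ x in V ∩ frontier Ω ∩ Metric.ball 0 R, ‖f n x‖ₑ
      ∂(Measure.hausdorffMeasure ((N : ℝ) - 1))) atTop (𝓝 0)) :
    ∃ x ∈ Ω, ∃ W ∈ 𝓝 x, ∀ᵐ z ∂(volume.restrict W), u z = 0 := by
  obtain ⟨U, hU, v, hv, hγ⟩ := hΩ.exists_epigraph x₀ hx₀
  set Q := (Submodule.span ℝ {v})ᗮ with hQ
  obtain ⟨K, γ, hγL, hepi⟩ := hγ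
  have hγ : Continuous γ := hγL.continuous
  set P := Q.orthogonalProjectionOnto with hP
  -- The exponent of the surface measure is the dimension of the hyperplane, on which the Hausdorff
  -- measure of that exponent is a Haar measure.
  have hdim : (N : ℝ) - 1 = Module.finrank ℝ Q := by
    have h1 := Submodule.finrank_add_finrank_orthogonal (Submodule.span ℝ {v})
    rw [finrank_span_singleton (by rintro rfl; simp at hv), finrank_euclideanSpace_fin] at h1
    have h2 : (1 : ℝ) + Module.finrank ℝ Q = N := by exact_mod_cast h1
    linarith
  rw [hdim] at hf
  set m : Measure Q := Measure.hausdorffMeasure (Module.finrank ℝ Q) with hm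
  set Ψ := graphHomeomorph hv hγ with hΨ
  have hΨa : ∀ y t, Ψ (y, t) = y + (γ y + t) • v := fun _ _ => rfl
  have hΨe : ∀ y t, Ψ (y, t) ∈ U → (Ψ (y, t) ∈ Ω ↔ 0 < t) := by
    intro y t hU
    rw [hepi _ hU, hΨa, orthogonalProjectionOnto_add_smul, inner_add_smul_eq hv]
    simp
  obtain ⟨c, hc0, hct, hc⟩ := exists_map_graphHomeomorph_eq_smul hv hγ m volume
  have hx₀Ω : x₀ ∉ Ω := by
    rw [hΩ.isOpen.frontier_eq] at hx₀; exact hx₀.2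
  -- The point is not above the graph since it lies outside the open set `Ω`, and not below since it
  -- is a limit of points of `Ω ∩ U`.
  have hgraph : Ψ (P x₀, 0) = x₀ := by
    have h1 : inner ℝ v x₀ ≤ γ (P x₀) := by
      rw [hepi _ (mem_of_mem_nhds hU)] at hx₀Ω; exact not_lt.1 hx₀Ω
    have h2 : γ (P x₀) ≤ inner ℝ v x₀ := by
      have hcl : x₀ ∈ closure (Ω ∩ U) := by
        rw [mem_closure_iff_nhds]
        intro t ht
        obtain ⟨y, hy, hyΩ⟩ := mem_closure_iff_nhds.1 (frontier_subset_closure hx₀) _ (inter_mem ht hU)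
        exact ⟨y, hy.1, hyΩ, hy.2⟩
      have hclosed : IsClosed {x | γ (P x) ≤ inner ℝ v x} :=
        isClosed_le (by fun_prop) (by fun_prop)
      exact closure_minimal (fun y hy => ((hepi y hy.2).1 hy.1).le) hclosed hcl
    rw [hΨa, le_antisymm h2 h1, add_zero]
    exact orthogonalProjectionOnto_add_inner_smul hv x₀
  set R := ‖x₀‖ + 1 with hR
  have hO : U ∩ (V ∩ Metric.ball 0 R) ∈ 𝓝 (Ψ (P x₀, 0)) := by
    rw [hgraph]
    refine inter_mem hU (inter_mem (hV.mem_nhds hx₀V) (Metric.isOpen_ball.mem_nhds ?_))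
    rw [mem_ball_zero_iff, hR]; linarith
  obtain ⟨r, hr, hball⟩ := Metric.mem_nhds_iff.1 (Ψ.continuous.continuousAt.preimage_mem_nhds hO)
  rw [← ball_prod_same] at hball
  set A := Metric.ball (P x₀) r with hA
  -- Half the radius keeps the closed interval `[0, T]` of heights inside the open ball.
  set T := r / 2 with hT
  have hT0 : 0 < T := half_pos hr
  have hmem : ∀ y ∈ A, ∀ t ∈ Icc 0 T, Ψ (y, t) ∈ U ∩ (V ∩ Metric.ball 0 R) := by
    intro y hy t ht
    refine hball ⟨hy, ?_⟩
    rw [mem_ball_zero_iff, Real.norm_of_nonneg ht.1]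
    linarith [ht.2]
  have hΩmem : ∀ y ∈ A, ∀ t ∈ Ioc 0 T, Ψ (y, t) ∈ Ω := fun y hy t ht =>
    (hΨe y t (hmem y hy t ⟨ht.1.le, ht.2⟩).1).2 ht.1
  have hfr : ∀ y ∈ A, Ψ (y, 0) ∈ V ∩ frontier Ω ∩ Metric.ball 0 R := by
    intro y hy
    have h0 := hmem y hy 0 ⟨le_rfl, hT0.le⟩
    refine ⟨⟨h0.2.1, ?_⟩, h0.2.2⟩
    rw [hΩ.isOpen.frontier_eq]
    refine ⟨?_, fun hmem => lt_irrefl _ ((hΨe y 0 h0.1).1 hmem)⟩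
    have hlim : Tendsto (fun t : ℝ => Ψ (y, t)) (𝓝[>] 0) (𝓝 (Ψ (y, 0))) :=
      ((Ψ.continuous.comp (Continuous.prodMk_right y)).tendsto 0).mono_left nhdsWithin_le_nhds
    refine mem_closure_of_tendsto hlim ?_
    filter_upwards [Ioc_mem_nhdsGT hT0] with t ht using hΩmem y hy t ht
  set b : Q → EuclideanSpace ℝ (Fin N) := fun y => Ψ (y, 0) with hb
  have hbc : Continuous b := Ψ.continuous.comp (Continuous.prodMk_left 0)
  have hbΨ : ∀ q : Q × ℝ, b q.1 + q.2 • v = Ψ q := by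
    rintro ⟨y, t⟩
    simp only [hb, hΨa, add_smul, add_zero, add_assoc]
  have hAm : MeasurableSet A := measurableSet_ball
  have hmap : ((m.restrict A).prod (volume.restrict (Ioc 0 T))).map (fun q => b q.1 + q.2 • v) ≤
      c • volume.restrict (Ω ∩ Metric.ball 0 R) := by
    simp_rw [hbΨ]
    rw [Measure.prod_restrict]
    refine Measure.le_iff.2 fun S hS => ?_
    rw [Measure.map_apply Ψ.measurable hS,
      Measure.restrict_apply' (hAm.prod measurableSet_Ioc), Measure.smul_apply,
      Measure.restrict_apply hS, ← Measure.smul_apply, ← hc,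
      Measure.map_apply Ψ.measurable
        (hS.inter (hΩ.isOpen.measurableSet.inter measurableSet_ball))]
    refine measure_mono ?_
    rintro ⟨y, t⟩ ⟨hyS, hy, ht⟩
    exact ⟨hyS, hΩmem y hy t ht, (hmem y hy t ⟨ht.1.le, ht.2⟩).2.2⟩
  -- The orthogonal projection is 1-Lipschitz and inverts `b`, so a piece of the graph has at least
  -- the Hausdorff measure of its shadow. This inequality suffices to move L¹ convergence from the
  -- boundary to the hyperplane, without an area formula.
  have hmapb : (m.restrict A).map b ≤ (Measure.hausdorffMeasure (Module.finrank ℝ Q)).restrict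
      (V ∩ frontier Ω ∩ Metric.ball 0 R) := by
    refine Measure.le_iff.2 fun S hS => ?_
    rw [Measure.map_apply hbc.measurable hS, Measure.restrict_apply' hAm, Measure.restrict_apply hS]
    refine le_trans (measure_mono ?_)
      (hausdorffMeasure_orthogonalProjectionOnto_le Q _ _ (Nat.cast_nonneg _))
    rintro y ⟨hyS, hy⟩
    exact ⟨b y, ⟨hyS, hfr y hy⟩, orthogonalProjectionOnto_add_smul y _⟩
  have hfb : Tendsto (fun n => ∫⁻ y in A, ‖f n (b y)‖ₑ ∂m) atTop (𝓝 0) := by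
    refine tendsto_of_tendsto_of_tendsto_of_le_of_le tendsto_const_nhds (hf R)
      (fun _ => zero_le) (fun n => ?_)
    rw [← lintegral_map (h.contDiff n).continuous.enorm.measurable hbc.measurable]
    exact lintegral_mono' hmapb le_rfl
  have hz := h.ae_eq_zero_on_segments hbc.measurable v hct hmap hfb
  simp_rw [hbΨ] at hz
  rw [Measure.prod_restrict] at hz
  have hWo : IsOpen (Ψ.symm ⁻¹' (A ×ˢ Ioo 0 T)) :=
    (Metric.isOpen_ball.prod isOpen_Ioo).preimage Ψ.symm.continuous
  refine ⟨Ψ (P x₀, T / 2), hΩmem _ (Metric.mem_ball_self hr) _ ⟨by linarith, by linarith⟩, _,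
    hWo.mem_nhds ?_, ?_⟩
  · rw [mem_preimage, Homeomorph.symm_apply_apply]
    exact ⟨Metric.mem_ball_self hr, by linarith, by linarith⟩
  · rw [ae_restrict_iff' hWo.measurableSet, ae_iff]
    rw [ae_restrict_iff' (hAm.prod measurableSet_Ioc), ae_iff] at hz
    set S := {z | ¬(z ∈ Ψ.symm ⁻¹' (A ×ˢ Ioo 0 T) → u z = 0)} with hS
    -- The null set is carried back through the homeomorphism; `c ≠ 0` then removes the factor.
    have h0 : (c • volume) S = 0 := by
      rw [← hc]
      change Measure.map Ψ.toMeasurableEquiv (m.prod volume) S = 0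
      rw [MeasurableEquiv.map_apply]
      refine measure_mono_null ?_ hz
      rintro q hq hq'
      refine hq fun hqA => hq' ?_
      rw [mem_preimage] at hqA
      have : q ∈ A ×ˢ Ioo 0 T := by simpa using hqA
      exact ⟨this.1, this.2.1, this.2.2.le⟩
    rw [Measure.smul_apply, smul_eq_mul, mul_eq_zero] at h0
    exact h0.resolve_left hc0

/-! ### Conclusion for integrable and square-integrable fields -/

/-- Functions in `L^p` with `1 ≤ p` are integrable on sets of finite measure. -/
theorem MeasureTheory.MemLp.setLIntegral_enorm_ne_top {α H : Type*} [MeasurableSpace α]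
    [NormedAddCommGroup H] {μ : Measure α} {f : α → H} {p : ENNReal} (hf : MemLp f p μ)
    (hp : 1 ≤ p) {s : Set α} (hs : μ s ≠ ⊤) : ∫⁻ x in s, ‖f x‖ₑ ∂μ ≠ ⊤ := by
  have : IsFiniteMeasure (μ.restrict s) := ⟨by rwa [Measure.restrict_apply_univ, lt_top_iff_ne_top]⟩
  exact ((hf.restrict s).integrable hp).2.ne

/-- Uniqueness for `∇ζ = G ζ` when `G` is integrable up to the boundary on bounded sets. -/
theorem ae_eq_zero_of_hasWeakDerivOn_of_traceVanishesOn {N : ℕ}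
    {F : Type*} [NormedAddCommGroup F] [NormedSpace ℝ F] [CompleteSpace F]
    {Ω Γ : Set (EuclideanSpace ℝ (Fin N))} (hΩ : IsLipschitzDomain Ω)
    (hΓ : ∃ V : Set (EuclideanSpace ℝ (Fin N)), IsOpen V ∧ Γ = V ∩ frontier Ω)
    (hΓne : Γ.Nonempty)
    {G : EuclideanSpace ℝ (Fin N) → F →L[ℝ] (EuclideanSpace ℝ (Fin N) →L[ℝ] F)}
    (hGm : AEMeasurable (fun x => ‖G x‖ₑ) (volume.restrict Ω))
    (hG : ∀ R, ∫⁻ x in Ω ∩ Metric.ball 0 R, ‖G x‖ₑ ≠ ⊤)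
    {ζ : EuclideanSpace ℝ (Fin N) → F} (hζ : HasWeakDerivOn Ω ζ (fun x => G x (ζ x)))
    (htr : TraceVanishesOn Ω Γ ζ) : ∀ᵐ x ∂(volume.restrict Ω), ζ x = 0 := by
  obtain ⟨V, hV, rfl⟩ := hΓ
  obtain ⟨x₀, hx₀V, hx₀⟩ := hΓne
  obtain ⟨T, ⟨-, Du, hDu, f, hf, hlim⟩, hT⟩ := htr
  have happrox : IsGronwallApprox Ω ζ Du (fun x => ‖G x‖ₑ) f :=
    { aesm := hζ.locallyIntegrableOn.aestronglyMeasurable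
      aesm_deriv := hDu.locallyIntegrableOn_deriv.aestronglyMeasurable
      aemeasurable := hGm
      lintegral_ne_top := hG
      bound := by
        -- The derivative supplied with the trace is a priori different from `G ζ`; uniqueness of
        -- weak derivatives identifies them almost everywhere.
        filter_upwards [hDu.ae_eq hΩ.isOpen hζ] with x hx
        rw [hx]
        exact ContinuousLinearMap.le_opENorm _ _
      contDiff := hf
      tendsto := fun R => (hlim R).1
      tendsto_deriv := fun R => (hlim R).2.1 }
  have hbdry : ∀ R, Tendsto (fun n => ∫⁻ x in V ∩ frontier Ω ∩ Metric.ball 0 R, ‖f n x‖ₑ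
      ∂(Measure.hausdorffMeasure ((N : ℝ) - 1))) atTop (𝓝 0) := by
    intro R
    refine tendsto_of_tendsto_of_tendsto_of_le_of_le tendsto_const_nhds (hlim R).2.2
      (fun _ => zero_le) (fun n => ?_)
    refine le_trans (le_of_eq (lintegral_congr_ae ?_)) (lintegral_mono_set
      (inter_subset_inter_left _ inter_subset_right : V ∩ frontier Ω ∩ Metric.ball 0 R ⊆ _))
    filter_upwards [ae_restrict_of_ae_restrict_of_subset inter_subset_left hT] with x hx
    rw [hx, sub_zero]
  obtain ⟨x, hx, W, hW, hu⟩ := happrox.exists_ae_eq_zero_near hΩ hV hx₀V hx₀ hbdry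
  exact happrox.ae_eq_zero_of_ae_eq_zero_near hΩ.isOpen hΩ.isConnected.isPreconnected hx hW hu

set_option maxSynthPendingDepth 5 in
/-- `L^p` tensor fields are integrable on sets of finite measure. -/
theorem aemeasurable_enorm_and_setLIntegral_ne_top {α E F : Type*} [MeasurableSpace α]
    {μ : Measure α} [NormedAddCommGroup E] [NormedSpace ℝ E] [NormedAddCommGroup F]
    [NormedSpace ℝ F] {G : α → F →L[ℝ] (E →L[ℝ] F)} {p : ENNReal} (hG : MemLp G p μ) (hp : 1 ≤ p) :
    AEMeasurable (fun x => ‖G x‖ₑ) μ ∧ ∀ s : Set α, μ s ≠ ⊤ → ∫⁻ x in s, ‖G x‖ₑ ∂μ ≠ ⊤ :=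
  ⟨hG.1.enorm, fun _ hs => hG.setLIntegral_enorm_ne_top hp hs⟩

theorem theorem1 {N : ℕ} (Ω Γ : Set (EuclideanSpace ℝ (Fin N))) (hΩ : IsLipschitzDomain Ω)
    (hΓ : ∃ V : Set (EuclideanSpace ℝ (Fin N)), IsOpen V ∧ Γ = V ∩ frontier Ω)
    (hΓne : Γ.Nonempty)
    (G : EuclideanSpace ℝ (Fin N) →
      EuclideanSpace ℝ (Fin N) →L[ℝ] (EuclideanSpace ℝ (Fin N) →L[ℝ] EuclideanSpace ℝ (Fin N))) :
    (MemLp G 1 (volume.restrict Ω) → ∀ ζ : EuclideanSpace ℝ (Fin N) → EuclideanSpace ℝ (Fin N),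
      MemW11 Ω ζ → HasWeakDerivOn Ω ζ (fun x => G x (ζ x)) → TraceVanishesOn Ω Γ ζ →
        ∀ᵐ x ∂(volume.restrict Ω), ζ x = 0) ∧
    (MemLp G 2 (volume.restrict Ω) →
      ∀ ζ : EuclideanSpace ℝ (Fin N) → EuclideanSpace ℝ (Fin N),
      MemLp ζ 2 (volume.restrict Ω) → HasWeakDerivOn Ω ζ (fun x => G x (ζ x)) →
      TraceVanishesOn Ω Γ ζ →
        ∀ᵐ x ∂(volume.restrict Ω), ζ x = 0) := by
  -- For every `p ≥ 1` the field is integrable on bounded parts of `Ω`, so the two claims are the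
  -- cases `p = 1` and `p = 2`.
  have key : ∀ p : ENNReal, 1 ≤ p → MemLp G p (volume.restrict Ω) →
      ∀ ζ : EuclideanSpace ℝ (Fin N) → EuclideanSpace ℝ (Fin N),
      HasWeakDerivOn Ω ζ (fun x => G x (ζ x)) → TraceVanishesOn Ω Γ ζ →
        ∀ᵐ x ∂(volume.restrict Ω), ζ x = 0 := by
    intro p hp hG ζ hζ htr
    obtain ⟨hGm, hGi⟩ := aemeasurable_enorm_and_setLIntegral_ne_top hG hp
    refine ae_eq_zero_of_hasWeakDerivOn_of_traceVanishesOn hΩ hΓ hΓne hGm (fun R => ?_) hζ htr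
    have h := hGi (Metric.ball 0 R)
      ((Measure.restrict_apply_le _ _).trans_lt measure_ball_lt_top).ne
    rwa [Measure.restrict_restrict measurableSet_ball, inter_comm] at h
  exact ⟨fun hG ζ _ => key 1 le_rfl hG ζ, fun hG ζ _ => key 2 (by norm_num) hG ζ⟩
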